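/- Let $\mathbb{K}\in\{\mathbb{R},\mathbb{C}\}$. For $N\in\mathbb{N}$ let $\mathscr{B}_N$ be the Fréchet space of all $f\in C^\infty(\mathbb{R};\mathbb{K})$ such that $$\|f\|_{N,n}=\max_{p\le n}\,\sup_{x\in\mathbb{R}}\frac{|f^{(p)}(x)|}{(1+|x|)^N}<\infty\qquad\text{for all } n\in\mathbb{N},$$ with the topology defined by the norms $\|\cdot\|_{N,n}$, $n\in\mathbb{N}$. Let $\mathscr{O}_C=\bigcup_{N\in\mathbb{N}}\mathscr{B}_N$ be the space of very slowly increasing smooth functions, endowed with the locally convex inductive limit topology, i.e. the finest locally convex vector space topology for which all inclusions $\mathscr{B}_N\to\mathscr{O}_C$ are continuous. Let $\varphi:\mathbb{R}\to\mathbb{R}$ be smooth and put $C_\varphi(f)=f\circ\varphi$. Then the following statements are equivalent: (i) $C_\varphi(\mathscr{O}_C)\subseteq\mathscr{O}_C$, i.e. $C_\varphi:\mathscr{O}_C\to\mathscr{O}_C$ is well defined. (ii) $C_\varphi:\mathscr{O}_C\to\mathscr{O}_C$ is well defined and continuous. (iii) There is $N\in\mathbb{N}$ such that $\displaystyle\sup_{x\in\mathbb{R}}\frac{|\varphi(x)|}{(1+|x|)^N}<\infty$,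 and for all integers $p,k\ge 1$ one has $\displaystyle\sup_{x\in\mathbb{R}}\frac{|\varphi^{(p)}(x)|}{(1+|x|)^{1/k}}<\infty$. -/

import Mathlib

open scoped ContDiff

namespace OCSpaces

/-- The function `1 + |x|`. -/
def wt (x : ℝ) : ℝ := 1 + |x|

theorem wt_pos (x : ℝ) : 0 < wt x := by
  unfold wt; positivity

theorem one_le_wt (x : ℝ) : 1 ≤ wt x := by
  unfold wt; linarith [abs_nonneg x]

variable (𝕜 : Type) [RCLike 𝕜]

/-- The smooth functions `f : ℝ → 𝕜` such that, for every `p`,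
`sup_x |f^(p)(x)| / (1 + |x|)^N < ∞`, as a linear space. -/
def weightedSubmodule (N : ℕ) : Submodule 𝕜 (ℝ → 𝕜) where
  carrier := {f | ContDiff ℝ ∞ f ∧
    ∀ p : ℕ, BddAbove (Set.range fun x : ℝ => ‖iteratedDeriv p f x‖ / wt x ^ N)}
  zero_mem' := by
    refine ⟨contDiff_const, fun p => ⟨0, ?_⟩⟩
    rintro _ ⟨x, rfl⟩
    simp
  add_mem' := by
    rintro f g ⟨hf, hf'⟩ ⟨hg, hg'⟩
    refine ⟨hf.add hg, fun p => ?_⟩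
    obtain ⟨A, hA⟩ := hf' p
    obtain ⟨B, hB⟩ := hg' p
    refine ⟨A + B, ?_⟩
    rintro _ ⟨x, rfl⟩
    have h : iteratedDeriv p (f + g) x = iteratedDeriv p f x + iteratedDeriv p g x :=
      iteratedDeriv_add ((hf.of_le (by exact_mod_cast le_top)).contDiffAt)
        ((hg.of_le (by exact_mod_cast le_top)).contDiffAt)
    have hw := pow_pos (wt_pos x) N
    calc ‖iteratedDeriv p (f + g) x‖ / wt x ^ N
        ≤ (‖iteratedDeriv p f x‖ + ‖iteratedDeriv p g x‖) / wt x ^ N := by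
          rw [h]; gcongr; exact norm_add_le _ _
      _ = ‖iteratedDeriv p f x‖ / wt x ^ N + ‖iteratedDeriv p g x‖ / wt x ^ N := add_div _ _ _
      _ ≤ A + B := add_le_add (hA ⟨x, rfl⟩) (hB ⟨x, rfl⟩)
  smul_mem' := by
    rintro c f ⟨hf, hf'⟩
    refine ⟨hf.const_smul c, fun p => ?_⟩
    obtain ⟨A, hA⟩ := hf' p
    refine ⟨‖c‖ * A, ?_⟩
    rintro _ ⟨x, rfl⟩
    have h : iteratedDeriv p (c • f) x = c • iteratedDeriv p f x :=
      iteratedDeriv_const_smul_field c f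
    simp only [h, norm_smul, mul_div_assoc]
    exact mul_le_mul_of_nonneg_left (hA ⟨x, rfl⟩) (norm_nonneg c)

/-- The Fréchet space of all smooth `f : ℝ → 𝕜` with
`sup_x |f^(p)(x)| / (1 + |x|)^N < ∞` for every `p`. -/
def Weighted (N : ℕ) : Type := weightedSubmodule 𝕜 N

noncomputable instance (N : ℕ) : AddCommGroup (Weighted 𝕜 N) :=
  inferInstanceAs (AddCommGroup (weightedSubmodule 𝕜 N))

noncomputable instance (N : ℕ) : Module 𝕜 (Weighted 𝕜 N) :=
  inferInstanceAs (Module 𝕜 (weightedSubmodule 𝕜 N))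

/-- The seminorm `f ↦ sup_x |f^(p)(x)| / (1 + |x|)^N`. -/
noncomputable def derivSeminorm (N p : ℕ) : Seminorm 𝕜 (Weighted 𝕜 N) :=
  Seminorm.of (fun f => ⨆ x : ℝ, ‖iteratedDeriv p f.1 x‖ / wt x ^ N)
    (by
      intro f g
      refine ciSup_le fun x => ?_
      have h : iteratedDeriv p (f + g).1 x = iteratedDeriv p f.1 x + iteratedDeriv p g.1 x :=
        iteratedDeriv_add ((f.2.1.of_le (by exact_mod_cast le_top)).contDiffAt)
          ((g.2.1.of_le (by exact_mod_cast le_top)).contDiffAt)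
      have hw := pow_pos (wt_pos x) N
      calc ‖iteratedDeriv p (f + g).1 x‖ / wt x ^ N
          ≤ (‖iteratedDeriv p f.1 x‖ + ‖iteratedDeriv p g.1 x‖) / wt x ^ N := by
            rw [h]; gcongr; exact norm_add_le _ _
        _ = ‖iteratedDeriv p f.1 x‖ / wt x ^ N + ‖iteratedDeriv p g.1 x‖ / wt x ^ N :=
            add_div _ _ _
        _ ≤ _ := add_le_add (le_ciSup (f.2.2 p) x) (le_ciSup (g.2.2 p) x))
    (by
      intro c f
      have h : ∀ x, iteratedDeriv p (c • f).1 x = c • iteratedDeriv p f.1 x := fun x =>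
        iteratedDeriv_const_smul_field c f.1
      simp only [h, norm_smul, mul_div_assoc]
      exact (Real.mul_iSup_of_nonneg (norm_nonneg c) _).symm)

/-- The norms `‖f‖_{N,n} = max_{p ≤ n} sup_x |f^(p)(x)| / (1 + |x|)^N`, `n ∈ ℕ`. -/
noncomputable def weightedNorm (N : ℕ) : SeminormFamily 𝕜 (Weighted 𝕜 N) ℕ :=
  fun n => (Finset.range (n + 1)).sup (derivSeminorm 𝕜 N)

/-- The projective limit topology, defined by the norms `‖·‖_{N,n}`, `n ∈ ℕ`. -/
noncomputable instance (N : ℕ) : TopologicalSpace (Weighted 𝕜 N) :=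
  (weightedNorm 𝕜 N).moduleFilterBasis.topology

theorem weightedSubmodule_mono : Monotone (weightedSubmodule 𝕜) := by
  rintro N M hNM f ⟨hf, hf'⟩
  refine ⟨hf, fun p => ?_⟩
  obtain ⟨A, hA⟩ := hf' p
  refine ⟨A, ?_⟩
  rintro _ ⟨x, rfl⟩
  refine le_trans ?_ (hA ⟨x, rfl⟩)
  have hw := pow_pos (wt_pos x) N
  have hle := pow_le_pow_right₀ (one_le_wt x) hNM
  dsimp only
  gcongr

/-- The union over `N` of the spaces `weightedSubmodule 𝕜 N`. -/
def ocSubmodule : Submodule 𝕜 (ℝ → 𝕜) where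
  carrier := {f | ∃ N : ℕ, f ∈ weightedSubmodule 𝕜 N}
  zero_mem' := ⟨0, Submodule.zero_mem _⟩
  add_mem' := by
    rintro f g ⟨N, hf⟩ ⟨M, hg⟩
    exact ⟨max N M, Submodule.add_mem _ (weightedSubmodule_mono 𝕜 (le_max_left N M) hf)
      (weightedSubmodule_mono 𝕜 (le_max_right N M) hg)⟩
  smul_mem' := by
    rintro c f ⟨N, hf⟩
    exact ⟨N, Submodule.smul_mem _ c hf⟩

/-- The space `𝒪_C` of very slowly increasing smooth functions `ℝ → 𝕜`. -/
def OC : Type := ocSubmodule 𝕜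

noncomputable instance : AddCommGroup (OC 𝕜) :=
  inferInstanceAs (AddCommGroup (ocSubmodule 𝕜))

noncomputable instance : Module 𝕜 (OC 𝕜) :=
  inferInstanceAs (Module 𝕜 (ocSubmodule 𝕜))

/-- The underlying real vector space (used only to speak about local convexity). -/
noncomputable instance instModuleRealOC : Module ℝ (OC 𝕜) :=
  Module.compHom (OC 𝕜) (algebraMap ℝ 𝕜)

instance : CoeFun (OC 𝕜) (fun _ => ℝ → 𝕜) := ⟨fun f => f.1⟩

/-- The inclusion of the `N`-th step into `𝒪_C`. -/
def incl (N : ℕ) (f : Weighted 𝕜 N) : OC 𝕜 := ⟨f.1, N, f.2⟩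

/-- The locally convex inductive limit topology on `𝒪_C`: the finest locally convex vector space
topology for which all inclusions of the steps are continuous. (In the lattice of topologies
`t ≤ s` means that `t` is finer than `s`.) -/
noncomputable instance : TopologicalSpace (OC 𝕜) :=
  sInf {t : TopologicalSpace (OC 𝕜) |
    @IsTopologicalAddGroup (OC 𝕜) t _ ∧
    @ContinuousSMul 𝕜 (OC 𝕜) _ _ t ∧
    @LocallyConvexSpace ℝ (OC 𝕜) _ _ _ _ t ∧
    ∀ N : ℕ, @Continuous (Weighted 𝕜 N) (OC 𝕜) _ t (incl 𝕜 N)}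

end OCSpaces

/-! Necessity is tested on three functions. The identity gives polynomial growth of `φ`. Next, `sin
∘ φ` and `cos ∘ φ` are bounded, and membership in `𝒪_C` gives all their derivatives one common
polynomial order. By a weighted Landau inequality, the optimal exponents of successive derivatives
form a bounded sequence that is convex wherever it increases; it starts at 0 and so stays there, and
every derivative is `O((1 + |x|) ^ ε)`. This class is closed under products and differences, hence
contains `φ' = cos φ · (sin φ)' - sin φ · (cos φ)'`.

Conversely, each term of the `n`-th derivative of `f ∘ φ` has at most `n` factors that are
derivatives of `φ`. With exponent `1 / (n + 1)` for each, they cost at most one power of the weight.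
So the step `N` is mapped continuously into the step `N₀ * N + 1`, an index independent of `n`, and
continuity passes to the inductive limit. -/

namespace OCSpaces

/-! ### Growth exponents and the Landau inequality -/

/-- `h x = O((1 + |x|) ^ s)`, uniformly on the real line. -/
def HasGrowth (h : ℝ → ℝ) (s : ℝ) : Prop := ∃ C : ℝ, ∀ x, |h x| ≤ C * wt x ^ s

theorem HasGrowth.exists_nonneg {h : ℝ → ℝ} {s : ℝ} (H : HasGrowth h s) :
    ∃ C : ℝ, 0 ≤ C ∧ ∀ x, |h x| ≤ C * wt x ^ s := by
  obtain ⟨C, hC⟩ := H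
  refine ⟨|C|, abs_nonneg C, fun x => (hC x).trans ?_⟩
  have := Real.rpow_nonneg (wt_pos x).le s
  gcongr
  exact le_abs_self C

theorem HasGrowth.mono {h : ℝ → ℝ} {s r : ℝ} (H : HasGrowth h s) (hsr : s ≤ r) :
    HasGrowth h r := by
  obtain ⟨C, hC0, hC⟩ := H.exists_nonneg
  refine ⟨C, fun x => (hC x).trans ?_⟩
  gcongr
  exact one_le_wt x

theorem HasGrowth.sub {g h : ℝ → ℝ} {s : ℝ} (hg : HasGrowth g s) (hh : HasGrowth h s) :
    HasGrowth (fun x => g x - h x) s := by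
  obtain ⟨A, hA⟩ := hg
  obtain ⟨B, hB⟩ := hh
  refine ⟨A + B, fun x => (abs_sub _ _).trans ?_⟩
  rw [add_mul]
  exact add_le_add (hA x) (hB x)

theorem wt_le_two_mul {x y t : ℝ} (hxy : x ≤ y) (hyx : y ≤ x + t) (ht : t ≤ 1) :
    wt y ≤ 2 * wt x := by
  unfold wt
  have h1 : |y| ≤ |y - x| + |x| := by simpa using abs_add_le (y - x) x
  have h2 : |y - x| ≤ 1 := abs_le.2 ⟨by linarith, by linarith⟩
  linarith [abs_nonneg x]

/-- A weighted Landau inequality: the growth exponent of a derivative is at most the mean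
of the exponents of its two neighbours. -/
theorem HasGrowth.deriv_of_deriv_deriv {h : ℝ → ℝ} (hd : Differentiable ℝ h)
    (hd' : Differentiable ℝ (deriv h)) {s r : ℝ} (hs : 0 ≤ s) (hsr : s ≤ r)
    (H0 : HasGrowth h s) (H2 : HasGrowth (deriv (deriv h)) r) :
    HasGrowth (deriv h) ((s + r) / 2) := by
  obtain ⟨A, hA0, hA⟩ := H0.exists_nonneg
  obtain ⟨B, hB0, hB⟩ := H2.exists_nonneg
  refine ⟨2 * (A * 2 ^ s) + B * 2 ^ r, fun x => ?_⟩
  set w := wt x with hw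
  have hw0 : 0 < w := wt_pos x
  -- This step length balances `w ^ s / t` against `t * w ^ r`. Since `t ≤ 1`, the weight at most
  -- doubles on `[x, x + t]`.
  set t : ℝ := w ^ (-((r - s) / 2)) with htdef
  have ht0 : 0 < t := Real.rpow_pos_of_pos hw0 _
  have ht1 : t ≤ 1 := Real.rpow_le_one_of_one_le_of_nonpos (one_le_wt x) (by linarith)
  have key : ∀ {q D : ℝ} {g : ℝ → ℝ}, 0 ≤ q → 0 ≤ D → (∀ y, |g y| ≤ D * wt y ^ q) →
      ∀ y, x ≤ y → y ≤ x + t → |g y| ≤ D * 2 ^ q * w ^ q := by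
    intro q D g hq hD hg y h1 h2
    refine (hg y).trans ?_
    rw [mul_assoc, ← Real.mul_rpow (by norm_num) hw0.le]
    have := (wt_pos y).le
    gcongr
    exact wt_le_two_mul h1 h2 ht1
  have hlt : x < x + t := by linarith
  obtain ⟨ξ, hξ, hξe⟩ := exists_deriv_eq_slope h hlt hd.continuous.continuousOn
    hd.differentiableOn
  obtain ⟨η, hη, hηe⟩ := exists_deriv_eq_slope (deriv h) hξ.1 hd'.continuous.continuousOn
    hd'.differentiableOn
  have e1 : w ^ s = t * w ^ ((s + r) / 2) := by
    rw [htdef, ← Real.rpow_add hw0]; congr 1; ring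
  have e2 : t * w ^ r = w ^ ((s + r) / 2) := by
    rw [htdef, ← Real.rpow_add hw0]; congr 1; ring
  have b1 : |deriv h ξ| ≤ 2 * (A * 2 ^ s) * w ^ ((s + r) / 2) := by
    rw [hξe, add_sub_cancel_left, abs_div, abs_of_pos ht0, div_le_iff₀ ht0]
    have h1 := key hs hA0 hA x le_rfl hlt.le
    have h2 := key hs hA0 hA (x + t) hlt.le le_rfl
    rw [e1] at h1 h2
    have h3 := abs_sub (h (x + t)) (h x)
    linarith
  have b2 : |deriv h ξ - deriv h x| ≤ B * 2 ^ r * w ^ ((s + r) / 2) := by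
    have hpos : 0 < ξ - x := by linarith [hξ.1]
    have : deriv h ξ - deriv h x = (ξ - x) * deriv (deriv h) η := by
      rw [hηe]; field_simp
    rw [this, abs_mul, abs_of_pos hpos, ← e2]
    have h1 := key (hs.trans hsr) hB0 hB η hη.1.le (hη.2.le.trans hξ.2.le)
    calc (ξ - x) * |deriv (deriv h) η| ≤ t * (B * 2 ^ r * w ^ r) := by
          gcongr; linarith [hξ.2]
      _ = _ := by ring
  have h4 : |deriv h x| ≤ |deriv h ξ| + |deriv h ξ - deriv h x| := by
    have := abs_sub (deriv h ξ) (deriv h ξ - deriv h x)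
    simpa using this
  rw [add_mul]
  linarith

/-- A bounded sequence that is convex wherever it increases is antitone from its first term. -/
theorem antitone_of_two_mul_le_add_max {a : ℕ → ℝ} {M : ℝ} (hM : ∀ j, a j ≤ M)
    (h : ∀ j, 2 * a (j + 1) ≤ a j + max (a j) (a (j + 2))) : Antitone a := by
  refine antitone_nat_of_succ_le fun j => ?_
  by_contra! hj
  set d := a (j + 1) - a j with hd
  have hd0 : 0 < d := by linarith
  -- An increase propagates: after one, the maximum in `h` must be the later term, and convexity
  -- keeps the increments at least `d`.
  have step : ∀ n, d ≤ a (j + n + 1) - a (j + n) := by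
    intro n
    induction n with
    | zero => simp [hd]
    | succ n ih =>
      have h1 := h (j + n)
      rcases max_cases (a (j + n)) (a (j + n + 2)) with h2 | h2
      · rw [h2.1] at h1; linarith
      · rw [h2.1] at h1
        have : a (j + (n + 1) + 1) = a (j + n + 2) := rfl
        have : a (j + (n + 1)) = a (j + n + 1) := rfl
        linarith
  have lin : ∀ n : ℕ, a j + n * d ≤ a (j + n) := by
    intro n
    induction n with
    | zero => simp
    | succ n ih =>
      have := step n
      push_cast
      have e : a (j + (n + 1)) = a (j + n + 1) := rfl
      linarith
  obtain ⟨n, hn⟩ := exists_nat_gt ((M - a j) / d)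
  rw [div_lt_iff₀ hd0] at hn
  linarith [lin n, hM (j + n)]

/-! ### Functions of slow growth -/

/-- Smooth functions all of whose derivatives are `O((1 + |x|) ^ ε)` for every `ε > 0`. -/
def SlowGrowth (h : ℝ → ℝ) : Prop :=
  ContDiff ℝ ∞ h ∧ ∀ j : ℕ, ∀ ε : ℝ, 0 < ε → HasGrowth (iteratedDeriv j h) ε

/-- A bounded smooth function whose derivatives share a polynomial growth rate has slow growth. -/
theorem SlowGrowth.of_bounded {h : ℝ → ℝ} (hh : ContDiff ℝ ∞ h) (h0 : HasGrowth h 0)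
    {M : ℝ} (hM : 0 ≤ M) (H : ∀ j, HasGrowth (iteratedDeriv j h) M) : SlowGrowth h := by
  let E : ℕ → Set ℝ := fun j => {s | 0 ≤ s ∧ HasGrowth (iteratedDeriv j h) s}
  have hbdd : ∀ j, BddBelow (E j) := fun j => ⟨0, fun s hs => hs.1⟩
  have hne : ∀ j, (E j).Nonempty := fun j => ⟨M, hM, H j⟩
  have hdiff : ∀ j, Differentiable ℝ (iteratedDeriv j h) := fun j =>
    hh.differentiable_iteratedDeriv j (by exact_mod_cast WithTop.coe_lt_top _)
  have hlt : ∀ j ε, sInf (E j) < ε → HasGrowth (iteratedDeriv j h) ε := by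
    intro j ε hε
    obtain ⟨s, hs, hsε⟩ := exists_lt_of_csInf_lt (hne j) hε
    exact hs.2.mono hsε.le
  have hnn : ∀ j, 0 ≤ sInf (E j) := fun j => le_csInf (hne j) fun s hs => hs.1
  have hanti : Antitone fun j => sInf (E j) := by
    refine antitone_of_two_mul_le_add_max (M := M) (fun j => csInf_le (hbdd j) ⟨hM, H j⟩)
      fun j => ?_
    -- The infima need not be attained, hence the slack `δ`. The `max` below secures the hypothesis
    -- `s ≤ r` of the Landau inequality.
    refine le_of_forall_pos_le_add fun δ hδ => ?_
    have h1 := hlt j (sInf (E j) + δ / 2) (by linarith)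
    have h2 := hlt (j + 2) (max (sInf (E j)) (sInf (E (j + 2))) + δ / 2)
      (by linarith [le_max_right (sInf (E j)) (sInf (E (j + 2)))])
    have e1 : iteratedDeriv (j + 1) h = deriv (iteratedDeriv j h) := iteratedDeriv_succ
    have e2 : iteratedDeriv (j + 2) h = deriv (deriv (iteratedDeriv j h)) := by
      rw [iteratedDeriv_succ, e1]
    rw [e2] at h2
    have h3 := HasGrowth.deriv_of_deriv_deriv (hdiff j) (e1 ▸ hdiff (j + 1))
      (by linarith [hnn j]) (by linarith [le_max_left (sInf (E j)) (sInf (E (j + 2)))]) h1 h2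
    rw [← e1] at h3
    have h4 : sInf (E (j + 1)) ≤ _ := csInf_le (hbdd (j + 1))
      ⟨by linarith [hnn j, le_max_left (sInf (E j)) (sInf (E (j + 2)))], h3⟩
    linarith
  refine ⟨hh, fun j ε hε => hlt j ε (lt_of_le_of_lt (hanti (Nat.zero_le j)) ?_)⟩
  refine lt_of_le_of_lt (csInf_le (hbdd 0) ⟨le_rfl, ?_⟩) hε
  rwa [iteratedDeriv_zero]

theorem SlowGrowth.deriv {h : ℝ → ℝ} (H : SlowGrowth h) : SlowGrowth (deriv h) := by
  refine ⟨((contDiff_infty_iff_deriv (𝕜 := ℝ)).1 H.1).2, fun j ε hε => ?_⟩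
  rw [← iteratedDeriv_succ']
  exact H.2 (j + 1) ε hε

theorem SlowGrowth.sub {g h : ℝ → ℝ} (hg : SlowGrowth g) (hh : SlowGrowth h) :
    SlowGrowth (fun x => g x - h x) := by
  refine ⟨hg.1.sub hh.1, fun j ε hε => ?_⟩
  obtain ⟨C, hC⟩ := (hg.2 j ε hε).sub (hh.2 j ε hε)
  refine ⟨C, fun x => ?_⟩
  have := iteratedDeriv_sub (n := j) (x := x)
    ((hg.1.of_le (by exact_mod_cast le_top)).contDiffAt)
    ((hh.1.of_le (by exact_mod_cast le_top)).contDiffAt)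
  change |iteratedDeriv j (g - h) x| ≤ _
  rw [this]
  exact hC x

theorem SlowGrowth.mul {g h : ℝ → ℝ} (hg : SlowGrowth g) (hh : SlowGrowth h) :
    SlowGrowth (fun x => g x * h x) := by
  refine ⟨hg.1.mul hh.1, fun j ε hε => ?_⟩
  choose A hA0 hA using fun i => (hg.2 i (ε / 2) (half_pos hε)).exists_nonneg
  choose B hB0 hB using fun i => (hh.2 i (ε / 2) (half_pos hε)).exists_nonneg
  refine ⟨∑ i ∈ Finset.range (j + 1), (j.choose i : ℝ) * A i * B (j - i), fun x => ?_⟩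
  have hle := norm_iteratedFDeriv_mul_le hg.1 hh.1 x (n := j) (by exact_mod_cast le_top)
  simp only [norm_iteratedFDeriv_eq_norm_iteratedDeriv, Real.norm_eq_abs] at hle
  refine hle.trans ?_
  rw [Finset.sum_mul]
  refine Finset.sum_le_sum fun i _ => ?_
  have e : wt x ^ ε = wt x ^ (ε / 2) * wt x ^ (ε / 2) := by
    rw [← Real.rpow_add (wt_pos x)]; congr 1; ring
  have hw := Real.rpow_nonneg (wt_pos x).le (ε / 2)
  calc (j.choose i : ℝ) * |iteratedDeriv i g x| * |iteratedDeriv (j - i) h x|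
      ≤ (j.choose i : ℝ) * (A i * wt x ^ (ε / 2)) * (B (j - i) * wt x ^ (ε / 2)) := by
        have := hA0 i
        gcongr
        · exact hA i x
        · exact hB (j - i) x
    _ = _ := by rw [e]; ring

/-- Pythagoras' identity recovers `φ'` from the bounded functions `sin ∘ φ`, `cos ∘ φ` and their
derivatives, although `φ` itself may be unbounded. -/
theorem deriv_eq_cos_mul_deriv_sin_sub {φ : ℝ → ℝ} (hφ : Differentiable ℝ φ) :
    deriv φ = fun x => Real.cos (φ x) * deriv (fun y => Real.sin (φ y)) x -
      Real.sin (φ x) * deriv (fun y => Real.cos (φ y)) x := by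
  ext x
  have h1 : deriv (fun y => Real.sin (φ y)) x = Real.cos (φ x) * deriv φ x :=
    ((hφ x).hasDerivAt.sin).deriv
  have h2 : deriv (fun y => Real.cos (φ y)) x = -Real.sin (φ x) * deriv φ x :=
    ((hφ x).hasDerivAt.cos).deriv
  rw [h1, h2]
  linear_combination -(deriv φ x) * Real.sin_sq_add_cos_sq (φ x)

/-! ### Membership in `𝒪_C` and necessity -/

theorem mem_weightedSubmodule_iff {𝕜 : Type} [RCLike 𝕜] {N : ℕ} {f : ℝ → 𝕜} :
    f ∈ weightedSubmodule 𝕜 N ↔ ContDiff ℝ ∞ f ∧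
      ∀ p : ℕ, ∃ C : ℝ, ∀ x : ℝ, ‖iteratedDeriv p f x‖ ≤ C * wt x ^ N := by
  refine and_congr_right fun _ => forall_congr' fun p => exists_congr fun C => ?_
  refine Set.forall_mem_range.trans (forall_congr' fun x => ?_)
  exact div_le_iff₀ (pow_pos (wt_pos x) N)

theorem norm_iteratedDeriv_ofReal_comp (𝕜 : Type) [RCLike 𝕜] {h : ℝ → ℝ} (hh : ContDiff ℝ ∞ h)
    (p : ℕ) (x : ℝ) :
    ‖iteratedDeriv p (fun y => (h y : 𝕜)) x‖ = |iteratedDeriv p h x| := by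
  have := (RCLike.ofRealLI (K := 𝕜)).norm_iteratedFDeriv_comp_left (hh.contDiffAt (x := x))
    (i := p) (by exact_mod_cast le_top)
  rw [norm_iteratedFDeriv_eq_norm_iteratedDeriv, norm_iteratedFDeriv_eq_norm_iteratedDeriv] at this
  exact this

theorem contDiff_ofReal_comp (𝕜 : Type) [RCLike 𝕜] {h : ℝ → ℝ} (hh : ContDiff ℝ ∞ h) :
    ContDiff ℝ ∞ fun y => (h y : 𝕜) :=
  (RCLike.ofRealLI (K := 𝕜)).contDiff.comp hh

theorem ofReal_comp_mem_ocSubmodule (𝕜 : Type) [RCLike 𝕜] {h : ℝ → ℝ} (hh : ContDiff ℝ ∞ h)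
    {N : ℕ} (H : ∀ p, ∃ C : ℝ, ∀ x, |iteratedDeriv p h x| ≤ C * wt x ^ N) :
    (fun y => (h y : 𝕜)) ∈ ocSubmodule 𝕜 := by
  refine ⟨N, mem_weightedSubmodule_iff.2 ⟨contDiff_ofReal_comp 𝕜 hh, fun p => ?_⟩⟩
  simpa only [norm_iteratedDeriv_ofReal_comp 𝕜 hh] using H p

theorem exists_hasGrowth_of_ofReal_comp_mem (𝕜 : Type) [RCLike 𝕜] {h : ℝ → ℝ}
    (hh : ContDiff ℝ ∞ h) (H : (fun y => (h y : 𝕜)) ∈ ocSubmodule 𝕜) :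
    ∃ N : ℕ, ∀ p, HasGrowth (iteratedDeriv p h) N := by
  obtain ⟨N, hN⟩ := H
  refine ⟨N, fun p => ?_⟩
  obtain ⟨C, hC⟩ := (mem_weightedSubmodule_iff.1 hN).2 p
  refine ⟨C, fun x => ?_⟩
  rw [Real.rpow_natCast, ← norm_iteratedDeriv_ofReal_comp 𝕜 hh]
  exact hC x

theorem abs_iteratedDeriv_sin_le_one_and_cos (p : ℕ) :
    (∀ x, |iteratedDeriv p Real.sin x| ≤ 1) ∧ ∀ x, |iteratedDeriv p Real.cos x| ≤ 1 := by
  induction p with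
  | zero => simp [Real.abs_sin_le_one, Real.abs_cos_le_one]
  | succ p ih =>
    rw [Real.iteratedDeriv_add_one_sin, Real.iteratedDeriv_add_one_cos]
    exact ⟨ih.2, fun x => by simpa using ih.1 x⟩

theorem exists_abs_iteratedDeriv_id_le (p : ℕ) :
    ∃ C : ℝ, ∀ x, |iteratedDeriv p (fun y : ℝ => y) x| ≤ C * wt x ^ 1 := by
  have hw := one_le_wt
  rcases p with _ | _ | p
  · exact ⟨1, fun x => by simp [wt]⟩
  · exact ⟨1, fun x => by simpa using hw x⟩
  · refine ⟨0, fun x => ?_⟩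
    have : deriv (fun y : ℝ => y) = fun _ => 1 := by ext; simp
    rw [iteratedDeriv_succ', this, iteratedDeriv_succ']
    simp

/-- Necessity of the growth conditions on the symbol. -/
theorem growth_of_comp_mem (𝕜 : Type) [RCLike 𝕜] {φ : ℝ → ℝ} (hφ : ContDiff ℝ ∞ φ)
    (H : ∀ f ∈ ocSubmodule 𝕜, f ∘ φ ∈ ocSubmodule 𝕜) :
    (∃ N : ℕ, HasGrowth φ N) ∧ ∀ p : ℕ, 1 ≤ p → ∀ ε : ℝ, 0 < ε →
      HasGrowth (iteratedDeriv p φ) ε := by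
  constructor
  · obtain ⟨N, hN⟩ := exists_hasGrowth_of_ofReal_comp_mem 𝕜 hφ
      (H _ (ofReal_comp_mem_ocSubmodule 𝕜 contDiff_id exists_abs_iteratedDeriv_id_le))
    exact ⟨N, by simpa using hN 0⟩
  · have slow : ∀ g : ℝ → ℝ, ContDiff ℝ ∞ g → (∀ p x, |iteratedDeriv p g x| ≤ 1) →
        SlowGrowth fun x => g (φ x) := by
      intro g hg hb
      have hgφ : ContDiff ℝ ∞ fun x => g (φ x) := hg.comp hφ
      obtain ⟨N, hN⟩ := exists_hasGrowth_of_ofReal_comp_mem 𝕜 hgφ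
        (H _ (ofReal_comp_mem_ocSubmodule 𝕜 (N := 0) hg fun p => ⟨1, by simpa using hb p⟩))
      exact .of_bounded hgφ ⟨1, fun x => by simpa using hb 0 (φ x)⟩ (Nat.cast_nonneg N) hN
    have hs := slow _ Real.contDiff_sin fun p => (abs_iteratedDeriv_sin_le_one_and_cos p).1
    have hc := slow _ Real.contDiff_cos fun p => (abs_iteratedDeriv_sin_le_one_and_cos p).2
    have hd : SlowGrowth (deriv φ) := by
      rw [deriv_eq_cos_mul_deriv_sin_sub (hφ.differentiable (by simp))]
      exact (hc.mul hs.deriv).sub (hs.mul hc.deriv)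
    intro p hp ε hε
    obtain ⟨q, rfl⟩ := Nat.exists_eq_add_of_le' hp
    rw [iteratedDeriv_succ']
    exact hd.2 q ε hε

/-! ### Sufficiency and continuity -/

/-- Uniform estimate of the derivatives of `f ∘ φ` through those of `f`. -/
theorem exists_norm_iteratedDeriv_comp_le (𝕜 : Type) [RCLike 𝕜] {φ : ℝ → ℝ}
    (hφ : ContDiff ℝ ∞ φ) {N₀ : ℕ} (h0 : HasGrowth φ N₀)
    (h : ∀ p : ℕ, 1 ≤ p → ∀ ε : ℝ, 0 < ε → HasGrowth (iteratedDeriv p φ) ε) (N n : ℕ) :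
    ∃ C : ℝ, 0 ≤ C ∧ ∀ (f : ℝ → 𝕜) (A : ℝ), ContDiff ℝ ∞ f → 0 ≤ A →
      (∀ j ≤ n, ∀ y, ‖iteratedDeriv j f y‖ ≤ A * wt y ^ N) →
      ∀ x, ‖iteratedDeriv n (f ∘ φ) x‖ ≤ C * A * wt x ^ (N₀ * N + 1) := by
  obtain ⟨C₀, hC₀, hφ0⟩ := h0.exists_nonneg
  -- With `n + 1` in place of `n`, the case `n = 0` needs no separate treatment; `D ^ n ≤ D ^ (n +
  -- 1)` absorbs the difference.
  have hε : (0 : ℝ) < 1 / ((n : ℝ) + 1) := by positivity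
  choose! B hB0 hB using fun p hp => (h p hp _ hε).exists_nonneg
  set K : ℝ := 1 + ∑ i ∈ Finset.Icc 1 n, B i with hK
  have hBK : ∀ i, 1 ≤ i → i ≤ n → B i ≤ K := fun i hi hin => by
    have := Finset.single_le_sum (f := B) (s := Finset.Icc 1 n)
      (fun j hj => hB0 j (Finset.mem_Icc.1 hj).1) (Finset.mem_Icc.2 ⟨hi, hin⟩)
    linarith
  have hK1 : 1 ≤ K := by
    have := Finset.sum_nonneg (f := B) (s := Finset.Icc 1 n)
      (fun j hj => hB0 j (Finset.mem_Icc.1 hj).1)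
    linarith
  refine ⟨n.factorial * (1 + C₀) ^ N * K ^ (n + 1), by positivity, fun f A hf hA hfA x => ?_⟩
  have hw0 := wt_pos x
  have hw1 := one_le_wt x
  set D : ℝ := K * wt x ^ (1 / ((n : ℝ) + 1)) with hD
  have hwε : 1 ≤ wt x ^ (1 / ((n : ℝ) + 1)) := Real.one_le_rpow hw1 hε.le
  have hD1 : 1 ≤ D := one_le_mul_of_one_le_of_one_le hK1 hwε
  have hwφ : wt (φ x) ≤ (1 + C₀) * wt x ^ N₀ := by
    have h1 := hφ0 x
    rw [Real.rpow_natCast] at h1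
    have h2 := one_le_pow₀ hw1 (n := N₀)
    unfold wt at *
    linarith
  have hpow : D ^ n ≤ K ^ (n + 1) * wt x := by
    refine (pow_le_pow_right₀ hD1 n.le_succ).trans_eq ?_
    rw [hD, mul_pow, ← Real.rpow_natCast (wt x ^ _), ← Real.rpow_mul hw0.le]
    congr 1
    push_cast
    rw [one_div, inv_mul_cancel₀ (by positivity), Real.rpow_one]
  have hmain := norm_iteratedFDeriv_comp_le (n := n) (C := A * wt (φ x) ^ N) (D := D) hf hφ
    (by exact_mod_cast le_top) x
    (fun i hi => by
      rw [norm_iteratedFDeriv_eq_norm_iteratedDeriv]; exact hfA i hi _)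
    (fun i hi hin => by
      rw [norm_iteratedFDeriv_eq_norm_iteratedDeriv]
      refine le_trans ?_ (le_self_pow₀ hD1 (by omega))
      refine (hB i hi x).trans ?_
      rw [hD]
      gcongr
      exact hBK i hi hin)
  rw [norm_iteratedFDeriv_eq_norm_iteratedDeriv] at hmain
  have hwφ0 := wt_pos (φ x)
  calc ‖iteratedDeriv n (f ∘ φ) x‖ ≤ n.factorial * (A * wt (φ x) ^ N) * D ^ n := hmain
    _ ≤ n.factorial * (A * ((1 + C₀) * wt x ^ N₀) ^ N) * (K ^ (n + 1) * wt x) := by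
        gcongr
    _ = _ := by rw [mul_pow, ← pow_mul]; ring

theorem norm_iteratedDeriv_le_weightedNorm {𝕜 : Type} [RCLike 𝕜] {N n j : ℕ} (hj : j ≤ n)
    (f : Weighted 𝕜 N) (x : ℝ) :
    ‖iteratedDeriv j f.1 x‖ ≤ weightedNorm 𝕜 N n f * wt x ^ N := by
  rw [← div_le_iff₀ (pow_pos (wt_pos x) N)]
  refine (le_ciSup (f.2.2 j) x).trans ?_
  exact Seminorm.le_finset_sup_apply (p := derivSeminorm 𝕜 N) (Finset.mem_range_succ_iff.2 hj)

theorem weightedNorm_le {𝕜 : Type} [RCLike 𝕜] {N n : ℕ} {f : Weighted 𝕜 N} {A : ℝ} (hA : 0 ≤ A)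
    (h : ∀ j ≤ n, ∀ x, ‖iteratedDeriv j f.1 x‖ ≤ A * wt x ^ N) : weightedNorm 𝕜 N n f ≤ A := by
  refine Seminorm.finset_sup_apply_le hA fun j hj => ?_
  refine ciSup_le fun x => (div_le_iff₀ (pow_pos (wt_pos x) N)).2 ?_
  exact h j (Finset.mem_range_succ_iff.1 hj) x

theorem withSeminorms_weightedNorm (𝕜 : Type) [RCLike 𝕜] (N : ℕ) :
    WithSeminorms (weightedNorm 𝕜 N) := ⟨rfl⟩

/-- A linear endomorphism of `𝒪_C` mapping each step continuously into some step is continuous. -/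
theorem continuous_of_steps {𝕜 : Type} [RCLike 𝕜] (T : OC 𝕜 →ₗ[𝕜] OC 𝕜)
    (h : ∀ N, ∃ M, ∃ S : Weighted 𝕜 N → Weighted 𝕜 M, Continuous S ∧
      ∀ f, T (incl 𝕜 N f) = incl 𝕜 M (S f)) : Continuous T := by
  refine continuous_sInf_rng.2 fun t ht => ?_
  obtain ⟨h1, h2, h3, h4⟩ := ht
  let Tℝ : OC 𝕜 →ₗ[ℝ] OC 𝕜 :=
    { toFun := T, map_add' := T.map_add, map_smul' := fun c f => T.map_smul (c : 𝕜) f }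
  -- The pullback of `t` along `T` is itself one of the competing topologies, so the inductive limit
  -- topology is finer than it.
  refine continuous_iff_le_induced.2 (sInf_le ⟨?_, ?_, ?_, fun N => ?_⟩)
  · exact topologicalAddGroup_induced T
  · exact continuousSMul_induced T
  · exact LocallyConvexSpace.induced Tℝ
  · obtain ⟨M, S, hS, hST⟩ := h N
    refine continuous_induced_rng.2 ?_
    have : T ∘ incl 𝕜 N = incl 𝕜 M ∘ S := funext hST
    rw [this]
    exact (h4 M).comp hS

/-- Composition with `φ` as a continuous linear operator, under the growth conditions. -/
theorem exists_continuousLinearMap_comp (𝕜 : Type) [RCLike 𝕜] {φ : ℝ → ℝ}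
    (hφ : ContDiff ℝ ∞ φ) {N₀ : ℕ} (h0 : HasGrowth φ N₀)
    (h : ∀ p : ℕ, 1 ≤ p → ∀ ε : ℝ, 0 < ε → HasGrowth (iteratedDeriv p φ) ε) :
    ∃ T : OC 𝕜 →L[𝕜] OC 𝕜, ∀ (f : OC 𝕜) (x : ℝ), T f x = f (φ x) := by
  choose C hC0 hC using exists_norm_iteratedDeriv_comp_le 𝕜 hφ h0 h
  have est : ∀ N n (f : Weighted 𝕜 N) x, ‖iteratedDeriv n (f.1 ∘ φ) x‖ ≤
      C N n * weightedNorm 𝕜 N n f * wt x ^ (N₀ * N + 1) := fun N n f x =>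
    hC N n f.1 _ f.2.1 (apply_nonneg _ _)
      (fun j hj y => norm_iteratedDeriv_le_weightedNorm hj f y) x
  have mem : ∀ N (f : Weighted 𝕜 N), f.1 ∘ φ ∈ weightedSubmodule 𝕜 (N₀ * N + 1) := fun N f =>
    mem_weightedSubmodule_iff.2 ⟨f.2.1.comp hφ, fun n => ⟨_, est N n f⟩⟩
  let S : ∀ N, Weighted 𝕜 N →ₗ[𝕜] Weighted 𝕜 (N₀ * N + 1) := fun N =>
    { toFun := fun f => ⟨f.1 ∘ φ, mem N f⟩
      map_add' := fun _ _ => rfl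
      map_smul' := fun _ _ => rfl }
  have hS : ∀ N, Continuous (S N) := fun N => by
    refine WithSeminorms.continuous_of_isBounded (withSeminorms_weightedNorm 𝕜 N)
      (withSeminorms_weightedNorm 𝕜 (N₀ * N + 1)) (S N) fun n => ?_
    -- The sum dominates the constants of all orders `j ≤ n` at once.
    have hsum : 0 ≤ ∑ i ∈ Finset.range (n + 1), C N i := Finset.sum_nonneg fun i _ => hC0 N i
    refine ⟨{n}, ⟨∑ i ∈ Finset.range (n + 1), C N i, hsum⟩, fun f => ?_⟩
    rw [Finset.sup_singleton]
    refine weightedNorm_le (mul_nonneg hsum (apply_nonneg _ _)) fun j hj x => ?_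
    refine hC N j f.1 _ f.2.1 (apply_nonneg (weightedNorm 𝕜 N n) f)
      (fun i hi y => norm_iteratedDeriv_le_weightedNorm (hi.trans hj) f y) x |>.trans ?_
    have := (wt_pos x).le
    have := apply_nonneg (weightedNorm 𝕜 N n) f
    have hj' := Finset.single_le_sum (f := C N) (fun i _ => hC0 N i)
      (Finset.mem_range_succ_iff.2 hj)
    exact mul_le_mul_of_nonneg_right (mul_le_mul_of_nonneg_right hj' this) (by positivity)
  let T : OC 𝕜 →ₗ[𝕜] OC 𝕜 :=
    { toFun := fun f => ⟨f.1 ∘ φ, by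
        obtain ⟨N, hN⟩ := f.2
        exact ⟨_, mem N ⟨f.1, hN⟩⟩⟩
      map_add' := fun _ _ => rfl
      map_smul' := fun _ _ => rfl }
  exact ⟨⟨T, continuous_of_steps T fun N => ⟨_, S N, hS N, fun _ => rfl⟩⟩, fun _ _ => rfl⟩

end OCSpaces

theorem mainTheorem3 (𝕜 : Type) [RCLike 𝕜] (φ : ℝ → ℝ) (hφ : ContDiff ℝ ∞ φ) :
    List.TFAE [
      -- the composition operator is well defined from `𝒪_C` to `𝒪_C`
      ∀ f ∈ OCSpaces.ocSubmodule 𝕜, f ∘ φ ∈ OCSpaces.ocSubmodule 𝕜,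
      -- the composition operator is a (well defined) continuous linear operator on `𝒪_C`
      ∃ T : OCSpaces.OC 𝕜 →L[𝕜] OCSpaces.OC 𝕜,
        ∀ (f : OCSpaces.OC 𝕜) (x : ℝ), T f x = f (φ x),
      -- the growth conditions on the symbol
      (∃ N : ℕ, ∃ C : ℝ, ∀ x : ℝ, |φ x| ≤ C * (1 + |x|) ^ N) ∧
        ∀ p k : ℕ, 1 ≤ p → 1 ≤ k →
          ∃ C : ℝ, ∀ x : ℝ, |iteratedDeriv p φ x| ≤ C * (1 + |x|) ^ (1 / (k : ℝ))] := by
  tfae_have 1 → 3 := by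
    intro H
    obtain ⟨⟨N, C, hC⟩, h⟩ := OCSpaces.growth_of_comp_mem 𝕜 hφ H
    refine ⟨⟨N, C, fun x => ?_⟩, fun p k hp hk => ?_⟩
    · rw [← Real.rpow_natCast]
      exact hC x
    · have : (0 : ℝ) < k := by exact_mod_cast hk
      exact h p hp (1 / (k : ℝ)) (by positivity)
  tfae_have 3 → 2 := by
    rintro ⟨⟨N, C, hC⟩, h⟩
    refine OCSpaces.exists_continuousLinearMap_comp 𝕜 hφ (N₀ := N) ⟨C, fun x => ?_⟩
      fun p hp ε hε => ?_
    · rw [Real.rpow_natCast]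
      exact hC x
    · obtain ⟨k, hk⟩ := exists_nat_one_div_lt hε
      have H : OCSpaces.HasGrowth (iteratedDeriv p φ) (1 / ((k + 1 : ℕ) : ℝ)) :=
        h p (k + 1) hp (by omega)
      exact H.mono (by push_cast; exact hk.le)
  tfae_have 2 → 1 := by
    rintro ⟨T, hT⟩ f hf
    have : f ∘ φ = (T ⟨f, hf⟩).1 := funext fun x => (hT ⟨f, hf⟩ x).symm
    rw [this]
    exact (T ⟨f, hf⟩).2
  tfae_finish
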